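/- Let $G$ be a finite connected loopless undirected multigraph (with at least one vertex) of genus $g=|E(G)|-|V(G)|+1$. A divisor is a function $D:V(G)\to\mathbb Z$, with degree $\deg(D)=\sum_v D(v)$; divisors are compared pointwise, and $D$ is effective if $D\ge 0$. Write $D\sim D'$ (linear equivalence) if $D-D'$ lies in the $\mathbb Z$-span of the columns of the Laplacian $\Delta$ of $G$ (the diagonal matrix of vertex degrees minus the adjacency matrix counting edges with multiplicity). The Baker–Norine rank $r(D)$ is one less than the minimum of $\deg(E)$ over effective divisors $E$ such that $D-E$ is not linearly equivalent to any effective divisor. A partial orientation $\mathcal O$ of $G$ is an orientation of a subset of the edges; its divisor is $D_{\mathcal O}(v)=\mathrm{indeg}_{\mathcal O}(v)-1$, where $\mathrm{indeg}_{\mathcal O}(v)$ is the number of edges oriented towards $v$. It is acyclic if it contains no directed cycle, and sourceless if every vertex has at least one edge oriented towards it. Let $D$ be a divisor on $G$ with $\deg(D)\le g-1$. Then: (i) $r(D)=-1$ if and only if there are a divisor $D'$ and an acyclic partial orientation $\mathcal O$ with $D\sim D'\le D_{\mathcal O}$; (ii) $r(D)\ge 0$ if and only if there is a sourceless partial orientation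 $\mathcal O$ with $D\sim D_{\mathcal O}$. -/

import Mathlib

open scoped Graph

namespace ChipFiring

noncomputable section

/-- A divisor on the multigraph `G`: an integer-valued function on the vertices,
ordered pointwise. -/
abbrev Divisor {α β : Type*} (G : Graph α β) : Type _ := V(G) → ℤ

/-- The degree of a divisor: the net number of chips. -/
def Divisor.deg {α β : Type*} {G : Graph α β} [Fintype V(G)] (D : Divisor G) : ℤ :=
  ∑ v, D v

/-- The genus (cyclomatic number) `|E(G)| - |V(G)| + 1` of a connected multigraph. -/
def genus {α β : Type*} (G : Graph α β) [Fintype V(G)] [Fintype E(G)] : ℤ :=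
  (Fintype.card E(G) : ℤ) - (Fintype.card V(G) : ℤ) + 1

/-- The number of edges incident to the vertex `v`. -/
def degree {α β : Type*} (G : Graph α β) (v : V(G)) : ℕ :=
  Nat.card {e : E(G) // G.Inc e v}

/-- The number of edges between the vertices `u` and `v`. -/
def multiplicity {α β : Type*} (G : Graph α β) (u v : V(G)) : ℕ :=
  Nat.card {e : E(G) // G.IsLink e u v}

open Classical in
/-- The Laplacian matrix: the diagonal matrix of degrees minus the adjacency matrix. -/
def laplacian {α β : Type*} (G : Graph α β) : Matrix V(G) V(G) ℤ :=
  Matrix.diagonal (fun v => (degree G v : ℤ)) - Matrix.of fun u v => (multiplicity G u v : ℤ)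

/-- Linear equivalence: the difference is an integral combination of columns of the Laplacian. -/
def LinEquiv {α β : Type*} {G : Graph α β} [Fintype V(G)] (D D' : Divisor G) : Prop :=
  ∃ f : V(G) → ℤ, D - D' = (laplacian G).mulVec f

/-- `D` minus some effective divisor of degree `n` is not equivalent to any effective divisor. -/
def Unwinnable {α β : Type*} {G : Graph α β} [Fintype V(G)] (D : Divisor G) (n : ℕ) : Prop :=
  ∃ E : Divisor G, 0 ≤ E ∧ E.deg = n ∧ ¬ ∃ E' : Divisor G, 0 ≤ E' ∧ LinEquiv (D - E) E'

/-- The Baker-Norine rank: one less than the least degree of an effective `E` such that `D - E`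
is not equivalent to an effective divisor. On a graph with a vertex such an `E` exists, see
`exists_unwinnable`. -/
def rank {α β : Type*} {G : Graph α β} [Fintype V(G)] (D : Divisor G) : ℤ :=
  ((sInf {n : ℕ | Unwinnable D n} : ℕ) : ℤ) - 1

/-- A partial orientation: each edge is either unoriented (`none`) or oriented towards one of its
two ends, its head. -/
structure PartialOrientation {α β : Type*} (G : Graph α β) where
  head : E(G) → Option V(G)
  inc_head : ∀ (e : E(G)) (v : V(G)), head e = some v → G.Inc e v

namespace PartialOrientation

/-- Some edge is oriented from its tail `u` to its head `v`. -/
def Arrow {α β : Type*} {G : Graph α β} (O : PartialOrientation G) (u v : V(G)) : Prop :=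
  ∃ e : E(G), O.head e = some v ∧ G.IsLink e u v

/-- The number of edges oriented towards `v`. -/
def indeg {α β : Type*} {G : Graph α β} (O : PartialOrientation G) (v : V(G)) : ℕ :=
  Nat.card {e : E(G) // O.head e = some v}

/-- The divisor associated to a partial orientation. -/
def divisor {α β : Type*} {G : Graph α β} (O : PartialOrientation G) : Divisor G :=
  fun v => (O.indeg v : ℤ) - 1

/-- A source is a vertex without incoming edges. -/
def IsSource {α β : Type*} {G : Graph α β} (O : PartialOrientation G) (v : V(G)) : Prop :=
  ∀ e : E(G), O.head e ≠ some v

/-- A partial orientation is sourceless if it has no sources. -/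
def Sourceless {α β : Type*} {G : Graph α β} (O : PartialOrientation G) : Prop :=
  ∀ v : V(G), ¬ O.IsSource v

/-- There is a directed cycle through distinct vertices `c 0 → c 1 → ⋯ → c n → c 0`
(the addition in `Fin (n + 1)` is cyclic). -/
def HasDirectedCycle {α β : Type*} {G : Graph α β} (O : PartialOrientation G) : Prop :=
  ∃ (n : ℕ) (c : Fin (n + 1) → V(G)), Function.Injective c ∧ ∀ i, O.Arrow (c i) (c (i + 1))

/-- A partial orientation is acyclic if it contains no directed cycle. -/
def Acyclic {α β : Type*} {G : Graph α β} (O : PartialOrientation G) : Prop :=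
  ¬ O.HasDirectedCycle

end PartialOrientation

theorem degree_eq_sum {α β : Type*} {G : Graph α β} [Fintype V(G)] [Fintype E(G)]
    (v : V(G)) : degree G v = ∑ u, multiplicity G u v := by
  classical
  unfold degree multiplicity
  rw [← Nat.card_sigma]
  refine Nat.card_congr (Equiv.symm ?_)
  refine Equiv.ofBijective (fun x => ⟨x.2.1, x.1.1, x.2.2.symm⟩) ⟨?_, ?_⟩
  · rintro ⟨u, e, he⟩ ⟨u', e', he'⟩ h
    obtain rfl : e = e' := congrArg Subtype.val h
    obtain rfl : u = u' := Subtype.ext (he.left_unique he')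
    rfl
  · rintro ⟨e, u, hu⟩
    exact ⟨⟨⟨u, hu.right_mem⟩, e, hu.symm⟩, rfl⟩

/-- Linearly equivalent divisors have the same degree. -/
theorem LinEquiv.deg_eq {α β : Type*} {G : Graph α β} [Fintype V(G)] [Fintype E(G)]
    {D D' : Divisor G} (h : LinEquiv D D') : D.deg = D'.deg := by
  classical
  obtain ⟨f, hf⟩ := h
  have h1 : D.deg - D'.deg = ∑ v, (laplacian G).mulVec f v := by
    rw [← hf]; simp [Divisor.deg]
  have h2 : ∑ v, (laplacian G).mulVec f v = 0 := by
    simp only [Matrix.mulVec, dotProduct]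
    rw [Finset.sum_comm]
    refine Finset.sum_eq_zero fun u _ => ?_
    rw [← Finset.sum_mul]
    have : ∑ v, laplacian G v u = 0 := by
      simp [laplacian, Matrix.diagonal_apply, degree_eq_sum]
    rw [this, zero_mul]
  linarith

/-- The set whose infimum defines the rank is nonempty. -/
theorem exists_unwinnable {α β : Type*} {G : Graph α β} [Fintype V(G)] [Fintype E(G)]
    [Nonempty V(G)] (D : Divisor G) : ∃ n : ℕ, Unwinnable D n := by
  classical
  obtain ⟨v⟩ := ‹Nonempty V(G)›
  have hE : Divisor.deg (Pi.single v (((D.deg.toNat + 1 : ℕ) : ℤ)) : Divisor G)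
      = ((D.deg.toNat + 1 : ℕ) : ℤ) := by
    simp [Divisor.deg]
  refine ⟨D.deg.toNat + 1, Pi.single v ((D.deg.toNat + 1 : ℕ) : ℤ), ?_, hE, ?_⟩
  · exact Pi.single_nonneg.2 (by positivity)
  · rintro ⟨E', h0, h⟩
    have h1 := h.deg_eq
    have h2 : 0 ≤ E'.deg := Finset.sum_nonneg fun u _ => h0 u
    have h3 : Divisor.deg (D - Pi.single v ((D.deg.toNat + 1 : ℕ) : ℤ))
        = D.deg - ((D.deg.toNat + 1 : ℕ) : ℤ) := by
      rw [← hE]; simp [Divisor.deg]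
    omega

end

end ChipFiring

namespace ChipFiring

/-! By the definition of the rank, `rank D = -1` says that `D` is not equivalent to an effective
divisor, so both claims concern this dichotomy.

(i) Let `D' ≤ O.divisor` with `O` acyclic, and subtract the Laplacian of any `f`. On the set where
`f` is maximal, `O` has a vertex with no arrow from that set; every edge oriented towards it comes
from a strictly lower value, so it loses at least its indegree in chips and goes into debt
(`Acyclic.not_effective`). Conversely, a `q`-reduced representative of an unwinnable divisor is
negative at `q`, so Dhar's burning algorithm orders all vertices; orienting each edge towards its
later end gives an acyclic orientation whose divisor dominates (`exists_reduced`,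
`exists_burning_order`).

(ii) Sourceless orientations have effective divisors. Conversely, by Hall's theorem an effective
divisor comes from a partial orientation as soon as every vertex set `T` meets at least as many
edges as the indegrees on `T` require, that is, `slack` is nonnegative (`exists_heads`). If this
fails, firing a smallest set of least slack keeps the divisor effective and leaves fewer sets of
that slack, or none (`exists_slack_nonneg`). The degree bound says that the whole vertex set has
nonnegative slack, so the fired set is proper. -/

/-- The indicator function of a finite set of vertices. -/
def indicator {V : Type*} [DecidableEq V] (S : Finset V) (v : V) : ℤ := if v ∈ S then 1 else 0

/-- The Laplacian of the multigraph whose edges `e` have the two ends `a e` and `b e`. -/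
def edgeLap {V E : Type*} [DecidableEq V] [Fintype E] (a b : E → V) (f : V → ℤ) (v : V) : ℤ :=
  ∑ e, ((if a e = v then 1 else 0) - (if b e = v then 1 else 0)) * (f (a e) - f (b e))

/-! ### Laplacian of an edge list -/

section EdgeLap

variable {V E : Type*} [DecidableEq V] [Fintype E] (a b : E → V)

theorem edgeLap_add (f g : V → ℤ) (v : V) :
    edgeLap a b (f + g) v = edgeLap a b f v + edgeLap a b g v := by
  simp only [edgeLap, ← Finset.sum_add_distrib, Pi.add_apply]
  exact Finset.sum_congr rfl fun e _ => by ring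

theorem edgeLap_smul (c : ℤ) (f : V → ℤ) (v : V) :
    edgeLap a b (c • f) v = c * edgeLap a b f v := by
  simp only [edgeLap, Finset.mul_sum, Pi.smul_apply, smul_eq_mul]
  exact Finset.sum_congr rfl fun e _ => by ring

/-- Discrete Green identity. The right side is symmetric in `f` and `g`, so the Laplacian is
self-adjoint. -/
theorem sum_mul_edgeLap [Fintype V] (g f : V → ℤ) :
    ∑ v, g v * edgeLap a b f v = ∑ e, (g (a e) - g (b e)) * (f (a e) - f (b e)) := by
  simp only [edgeLap, Finset.mul_sum]
  rw [Finset.sum_comm]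
  refine Finset.sum_congr rfl fun e _ => ?_
  simp only [← mul_assoc, ← Finset.sum_mul, mul_sub, Finset.sum_sub_distrib, mul_ite, mul_one,
    mul_zero, Finset.sum_ite_eq, Finset.mem_univ, if_true]

theorem edgeLap_indicator_nonpos {S : Finset V} {v : V} (hv : v ∉ S) :
    edgeLap a b (indicator S) v ≤ 0 := by
  refine Finset.sum_nonpos fun e _ => ?_
  simp only [indicator]
  split_ifs <;> simp_all

/-! ### Reduced divisors and Dhar's algorithm -/

/-- If every vertex other than `q` has a neighbour that is closer to `q`, some function has
positive Laplacian away from `q`. -/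
theorem exists_potential [Fintype V] (q : V) (d : V → ℕ) (hq : d q = 0)
    (hd : ∀ v, v ≠ q → ∃ e, (a e = v ∧ d (b e) < d v) ∨ (b e = v ∧ d (a e) < d v)) :
    ∃ w : V → ℤ, w q = 0 ∧ (∀ v, 0 ≤ w v) ∧ ∀ v, v ≠ q → 1 ≤ edgeLap a b w v := by
  classical
  set C : ℤ := Fintype.card E + 1 with hC
  set N : ℕ := ∑ v, d v with hN
  have hdN : ∀ v, d v ≤ N := fun v =>
    Finset.single_le_sum (f := d) (fun _ _ => Nat.zero_le _) (Finset.mem_univ v)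
  have hC1 : 1 ≤ C := by omega
  -- The increments decay geometrically in the distance: one edge to a closer neighbour gains at
  -- least `C * K - K`, any other edge loses less than `K`, and `C` exceeds the number of edges.
  refine ⟨fun v => C ^ N - C ^ (N - d v), by simp [hq], fun v => ?_, fun v hv => ?_⟩
  · have := pow_le_pow_right₀ hC1 (Nat.sub_le N (d v))
    simpa using this
  have hpos : ∀ n : ℕ, 1 ≤ C ^ n := fun n => one_le_pow₀ hC1
  obtain ⟨e₀, he₀⟩ := hd v hv
  set K := C ^ (N - d v) with hK
  have hstep : ∀ u, d u < d v → C * K ≤ C ^ (N - d u) := fun u hu => by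
    rw [hK, ← pow_succ']
    exact pow_le_pow_right₀ hC1 (by have := hdN v; omega)
  have hK1 : 1 ≤ K := hpos _
  calc (1 : ℤ) ≤ K := hK1
    _ = ∑ e : E, (-K + if e = e₀ then C * K else 0) := by
      rw [Finset.sum_add_distrib, Finset.sum_ite_eq']
      simp [hC]; ring
    _ ≤ _ := by
      refine Finset.sum_le_sum fun e _ => ?_
      have ha := hpos (N - d (a e))
      have hb := hpos (N - d (b e))
      by_cases he : e = e₀
      · subst he
        rcases he₀ with ⟨h1, h2⟩ | ⟨h1, h2⟩
        · have h3 : b e ≠ v := by rintro h; rw [h] at h2; exact lt_irrefl _ h2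
          have := hstep _ h2
          simp only [h1, h3, if_true, if_false, ← hK]; linarith
        · have h3 : a e ≠ v := by rintro h; rw [h] at h2; exact lt_irrefl _ h2
          have := hstep _ h2
          simp only [h1, h3, if_true, if_false, ← hK]; linarith
      · by_cases h1 : a e = v <;> by_cases h2 : b e = v <;>
          simp only [h1, h2, he, if_true, if_false, ← hK] <;> linarith

/-- Every divisor is equivalent to a `q`-reduced one. -/
theorem exists_reduced [Fintype V] (q : V) (w : V → ℤ) (hq : w q = 0) (hw : ∀ v, 0 ≤ w v)
    (hw' : ∀ v, v ≠ q → 1 ≤ edgeLap a b w v) (D : V → ℤ) :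
    ∃ f : V → ℤ, (∀ v, v ≠ q → 0 ≤ D v - edgeLap a b f v) ∧
      ∀ S : Finset V, S.Nonempty → q ∉ S →
        ∃ v ∈ S, D v - edgeLap a b f v < edgeLap a b (indicator S) v := by
  -- Since `w q = 0`, this weight ignores the debt at `q`. A legal firing of a set avoiding `q`
  -- decreases it, so a minimizer is reduced.
  let φ : (V → ℤ) → ℕ := fun f => (∑ v, w v * (D v - edgeLap a b f v)).toNat
  have hne : {f : V → ℤ | ∀ v, v ≠ q → 0 ≤ D v - edgeLap a b f v}.Nonempty := by
    refine ⟨(-∑ v, |D v|) • w, fun v hv => ?_⟩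
    rw [edgeLap_smul]
    have h1 : |D v| ≤ ∑ v, |D v| :=
      Finset.single_le_sum (f := fun v => |D v|) (fun _ _ => abs_nonneg _) (Finset.mem_univ v)
    have h2 := hw' v hv
    have h3 := neg_abs_le (D v)
    have h4 := abs_nonneg (D v)
    nlinarith
  obtain ⟨f, hf, hmin⟩ := (measure φ).wf.has_min _ hne
  refine ⟨f, hf, fun S hS hqS => ?_⟩
  by_contra! hcon
  have hf' : ∀ v, v ≠ q → 0 ≤ D v - edgeLap a b (f + indicator S) v := fun v hv => by
    rw [edgeLap_add]
    by_cases hvS : v ∈ S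
    · have := hcon v hvS; linarith
    · have := hf v hv
      have := edgeLap_indicator_nonpos a b hvS
      linarith
  have hnn : 0 ≤ ∑ v, w v * (D v - edgeLap a b (f + indicator S) v) := by
    refine Finset.sum_nonneg fun v _ => ?_
    by_cases hv : v = q
    · simp [hv, hq]
    · exact mul_nonneg (hw v) (hf' v hv)
  have hlt : ∑ v, w v * (D v - edgeLap a b (f + indicator S) v)
      < ∑ v, w v * (D v - edgeLap a b f v) := by
    have h1 : ∑ v, w v * edgeLap a b (indicator S) v
        = ∑ v, indicator S v * edgeLap a b w v := by
      rw [sum_mul_edgeLap, sum_mul_edgeLap]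
      exact Finset.sum_congr rfl fun e _ => mul_comm _ _
    have h2 : 0 < ∑ v, indicator S v * edgeLap a b w v := by
      simp only [indicator, ite_mul, one_mul, zero_mul, Finset.sum_ite_mem, Finset.univ_inter]
      refine Finset.sum_pos (fun v hv => ?_) hS
      have := hw' v (by rintro rfl; exact hqS hv)
      linarith
    have h3 : ∑ v, w v * (D v - edgeLap a b (f + indicator S) v)
        = ∑ v, w v * (D v - edgeLap a b f v) - ∑ v, w v * edgeLap a b (indicator S) v := by
      rw [← Finset.sum_sub_distrib]
      exact Finset.sum_congr rfl fun v _ => by rw [edgeLap_add]; ring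
    linarith
  refine hmin _ hf' ?_
  change φ _ < φ _
  simp only [φ]
  omega

/-- Dhar's burning algorithm: if no set can be fired, the vertices can be ordered so that every
vertex `v` has more than `D v` edges to earlier vertices. -/
theorem exists_burning_order (D : V → ℤ)
    (hD : ∀ S : Finset V, S.Nonempty → ∃ v ∈ S, D v < edgeLap a b (indicator S) v)
    (S : Finset V) :
    ∃ ρ : V → ℕ, Set.InjOn ρ S ∧ ∀ v ∈ S, D v < ∑ e,
      ((if a e = v ∧ (b e ∉ S ∨ ρ (b e) < ρ v) then 1 else 0) +
        if b e = v ∧ (a e ∉ S ∨ ρ (a e) < ρ v) then 1 else 0 : ℤ) := by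
  induction S using Finset.strongInduction with
  | H S ih =>
    rcases S.eq_empty_or_nonempty with rfl | hS
    · exact ⟨fun _ => 0, by simp, by simp⟩
    obtain ⟨v, hvS, hv⟩ := hD S hS
    obtain ⟨ρ, hρ, hlt⟩ := ih _ (Finset.erase_ssubset hvS)
    -- Vertices outside `S` count as burnt. The vertex `v` burns next, so it gets rank `0` and the
    -- ranks on `S.erase v` shift up by one.
    refine ⟨fun u => if u = v then 0 else ρ u + 1, fun x hx y hy hxy => ?_, fun u hu => ?_⟩
    · by_cases h1 : x = v <;> by_cases h2 : y = v <;> simp [h1, h2] at hxy ⊢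
      exact hρ (by simp_all) (by simp_all) hxy
    · by_cases huv : u = v
      · subst huv
        refine hv.trans_le (Finset.sum_le_sum fun e _ => ?_)
        simp only [indicator]
        by_cases h1 : a e = u <;> by_cases h2 : b e = u <;> by_cases h3 : a e ∈ S <;>
          by_cases h4 : b e ∈ S <;> simp_all
      · refine (hlt u (by simp_all)).trans_le (Finset.sum_le_sum fun e _ => add_le_add ?_ ?_)
        · by_cases h1 : a e = u ∧ (b e ∉ S.erase v ∨ ρ (b e) < ρ u)
          · rw [if_pos h1, if_pos]
            refine ⟨h1.1, ?_⟩
            by_cases h3 : b e = v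
            · simp [h3, huv]
            · simpa [h3, huv] using h1.2
          · rw [if_neg h1]; split_ifs <;> simp
        · by_cases h1 : b e = u ∧ (a e ∉ S.erase v ∨ ρ (a e) < ρ u)
          · rw [if_pos h1, if_pos]
            refine ⟨h1.1, ?_⟩
            by_cases h3 : a e = v
            · simp [h3, huv]
            · simpa [h3, huv] using h1.2
          · rw [if_neg h1]; split_ifs <;> simp

/-! ### Slack and firing of deficient sets -/

/-- The number of edges that meet `S`, minus the number of chips that a partial orientation with
divisor `D` needs there. -/
def slack (D : V → ℤ) (S : Finset V) : ℤ :=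
  ∑ e, (if a e ∈ S ∨ b e ∈ S then 1 else 0) - ∑ v ∈ S, (D v + 1)

theorem slack_fire [Fintype V] (D : V → ℤ) (S T : Finset V) :
    slack a b (fun v => D v - edgeLap a b (indicator S) v) T = slack a b D T +
      ∑ e, (indicator T (a e) - indicator T (b e)) *
        (indicator S (a e) - indicator S (b e)) := by
  have h : ∑ v ∈ T, edgeLap a b (indicator S) v
      = ∑ v, indicator T v * edgeLap a b (indicator S) v := by
    simp [indicator]
  rw [← sum_mul_edgeLap, ← h]
  simp only [slack, Finset.sum_add_distrib, Finset.sum_sub_distrib]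
  ring

/-- Submodularity of `slack`, with room to spare: the firing term of `slack_fire` is negative only
on edges between `S \ T` and `T \ S`, and exactly there the submodular inequality has a surplus of
one. -/
theorem slack_union_add_slack_inter_le [Fintype V] (D : V → ℤ) (S T : Finset V) :
    slack a b D (S ∪ T) + slack a b D (S ∩ T) ≤
      slack a b (fun v => D v - edgeLap a b (indicator S) v) T + slack a b D S := by
  rw [slack_fire]
  have h1 := Finset.sum_union_inter (s₁ := S) (s₂ := T) (f := fun v => D v + 1)
  have h2 : ∑ e, (if a e ∈ S ∪ T ∨ b e ∈ S ∪ T then (1 : ℤ) else 0)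
      + ∑ e, (if a e ∈ S ∩ T ∨ b e ∈ S ∩ T then (1 : ℤ) else 0)
      ≤ ∑ e, (if a e ∈ T ∨ b e ∈ T then (1 : ℤ) else 0) +
        ∑ e, (indicator T (a e) - indicator T (b e)) *
          (indicator S (a e) - indicator S (b e)) +
        ∑ e, (if a e ∈ S ∨ b e ∈ S then (1 : ℤ) else 0) := by
    simp only [← Finset.sum_add_distrib]
    refine Finset.sum_le_sum fun e _ => ?_
    simp only [indicator, Finset.mem_union, Finset.mem_inter]
    by_cases h1 : a e ∈ S <;> by_cases h2 : a e ∈ T <;> by_cases h3 : b e ∈ S <;>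
      by_cases h4 : b e ∈ T <;> simp [h1, h2, h3, h4]
  simp only [slack]
  linarith

/-- The edges that meet `S` only at `v` are those from `v` to the complement, and `edgeLap a b
(indicator S) v` counts them. -/
theorem slack_erase (hab : ∀ e, a e ≠ b e) (D : V → ℤ) {S : Finset V} {v : V} (hv : v ∈ S) :
    slack a b D (S.erase v) = slack a b D S + D v + 1 - edgeLap a b (indicator S) v := by
  have h1 := Finset.sum_erase_add S (fun v => D v + 1) hv
  have h2 : ∑ e, (if a e ∈ S.erase v ∨ b e ∈ S.erase v then (1 : ℤ) else 0)
      + edgeLap a b (indicator S) v = ∑ e, (if a e ∈ S ∨ b e ∈ S then (1 : ℤ) else 0) := by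
    simp only [edgeLap, ← Finset.sum_add_distrib]
    refine Finset.sum_congr rfl fun e _ => ?_
    have := hab e
    simp only [indicator, Finset.mem_erase]
    by_cases h1 : a e = v <;> by_cases h2 : b e = v <;> by_cases h3 : a e ∈ S <;>
      by_cases h4 : b e ∈ S <;> simp_all
  simp only [slack]
  linarith

/-- An effective divisor of degree at most `|E| - |V|` on a connected multigraph is equivalent to an
effective divisor with nonnegative slack. -/
theorem exists_slack_nonneg [Fintype V] (hab : ∀ e, a e ≠ b e)
    (hconn : ∀ S : Finset V, S.Nonempty → S ≠ Finset.univ → ∃ e, ¬ (a e ∈ S ↔ b e ∈ S))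
    (m : ℕ) : ∀ D : V → ℤ, (∀ v, 0 ≤ D v) → 0 ≤ slack a b D Finset.univ →
      (∀ T, -(m : ℤ) ≤ slack a b D T) →
      ∃ f : V → ℤ, (∀ v, 0 ≤ D v - edgeLap a b f v) ∧
        ∀ T, 0 ≤ slack a b (fun v => D v - edgeLap a b f v) T := by
  induction m with
  | zero =>
    intro D hD _ hT
    have h0 : ∀ v, edgeLap a b 0 v = 0 := fun v => by simp [edgeLap]
    exact ⟨0, by simpa [h0] using hD, by simpa [h0] using hT⟩
  | succ m ihm =>
    -- The outer induction bounds the depth of the worst deficit, the inner one the number of sets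
    -- that attain it.
    suffices H : ∀ (c : ℕ) (D : V → ℤ), (∀ v, 0 ≤ D v) → 0 ≤ slack a b D Finset.univ →
        (∀ T, -((m + 1 : ℕ) : ℤ) ≤ slack a b D T) →
        (Finset.univ.filter fun T => slack a b D T = -((m + 1 : ℕ) : ℤ)).card ≤ c →
        ∃ f : V → ℤ, (∀ v, 0 ≤ D v - edgeLap a b f v) ∧
          ∀ T, 0 ≤ slack a b (fun v => D v - edgeLap a b f v) T from
      fun D h1 h2 h3 => H _ D h1 h2 h3 le_rfl
    intro c
    induction c with
    | zero =>
      intro D hD huniv hT hc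
      refine ihm D hD huniv fun T => ?_
      have h1 := hT T
      have h2 : slack a b D T ≠ -((m + 1 : ℕ) : ℤ) := fun h => by
        have : T ∈ Finset.univ.filter fun T => slack a b D T = -((m + 1 : ℕ) : ℤ) := by simp [h]
        rw [Finset.card_eq_zero.1 (Nat.le_zero.1 hc)] at this
        simp at this
      omega
    | succ c ihc =>
      intro D hD huniv hT hc
      rcases (Finset.univ.filter fun T => slack a b D T = -((m + 1 : ℕ) : ℤ)).eq_empty_or_nonempty
        with hemp | hne
      · exact ihc D hD huniv hT (by rw [hemp]; simp)
      obtain ⟨S, hS, hmin⟩ := Finset.exists_min_image _ Finset.card hne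
      simp only [Finset.mem_filter, Finset.mem_univ, true_and] at hS hmin
      have hSne : S.Nonempty := by
        rw [Finset.nonempty_iff_ne_empty]
        rintro rfl
        simp [slack] at hS
        omega
      have hSuniv : S ≠ Finset.univ := by
        rintro rfl
        omega
      have hsub := slack_union_add_slack_inter_le a b D S
      set D' : V → ℤ := fun v => D v - edgeLap a b (indicator S) v with hD'
      have hD'0 : ∀ v, 0 ≤ D' v := fun v => by
        by_cases hv : v ∈ S
        · have h1 := slack_erase a b hab D hv
          have h2 := hT (S.erase v)
          have h3 : slack a b D (S.erase v) ≠ -((m + 1 : ℕ) : ℤ) := fun h =>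
            absurd (hmin _ h) (not_le.2 (Finset.card_erase_lt_of_mem hv))
          simp only [hD']
          omega
        · have := edgeLap_indicator_nonpos a b hv
          have := hD v
          simp only [hD']
          omega
      have hT' : ∀ T, -((m + 1 : ℕ) : ℤ) ≤ slack a b D' T := fun T => by
        have h1 := hsub T
        have h2 := hT (S ∪ T)
        have h3 := hT (S ∩ T)
        linarith
      have huniv' : 0 ≤ slack a b D' Finset.univ := by
        have h1 := slack_fire a b D S Finset.univ
        simp only [indicator, Finset.mem_univ, if_true, sub_self, zero_mul,
          Finset.sum_const_zero, add_zero] at h1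
        exact huniv.trans h1.ge
      have hS' : slack a b D S < slack a b D' S := by
        rw [hD', slack_fire]
        obtain ⟨e, he⟩ := hconn S hSne hSuniv
        refine lt_add_of_pos_right _ (Finset.sum_pos' (fun e _ => mul_self_nonneg _)
          ⟨e, Finset.mem_univ _, ?_⟩)
        simp only [indicator]
        by_cases h1 : a e ∈ S <;> by_cases h2 : b e ∈ S <;> simp_all
      -- A worst set `T` after firing forces `S ∪ T` and `S ∩ T` to be worst before it. Minimality
      -- gives `S ⊆ T`, so `T` was already worst, while `S` itself no longer is.
      have hss : (Finset.univ.filter fun T => slack a b D' T = -((m + 1 : ℕ) : ℤ)) ⊂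
          Finset.univ.filter fun T => slack a b D T = -((m + 1 : ℕ) : ℤ) := by
        rw [Finset.ssubset_iff_of_subset]
        · exact ⟨S, by simp [hS], by simp; omega⟩
        · intro T hTm
          simp only [Finset.mem_filter, Finset.mem_univ, true_and] at hTm ⊢
          have h1 := hsub T
          have h2 := hT (S ∪ T)
          have h3 := hT (S ∩ T)
          have h4 : S ∩ T = S := Finset.eq_of_subset_of_card_le Finset.inter_subset_left
            (hmin _ (by omega))
          rw [Finset.inter_eq_left] at h4
          rw [Finset.union_eq_right.2 h4] at h1 h2
          rw [Finset.inter_eq_left.2 h4] at h1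
          omega
      obtain ⟨f, hf, hf'⟩ := ihc D' hD'0 huniv' hT'
        (by have := Finset.card_lt_card hss; omega)
      have key : ∀ v, D' v - edgeLap a b f v = D v - edgeLap a b (indicator S + f) v := fun v => by
        rw [edgeLap_add]; simp only [hD']; ring
      simp only [key] at hf hf'
      exact ⟨_, hf, hf'⟩

/-! ### Orientations from Hall's theorem -/

/-- A divisor at least `-1` with nonnegative slack comes from a partial orientation. -/
theorem exists_heads [Fintype V] (D : V → ℤ) (hD : ∀ v, 0 ≤ D v + 1)
    (hs : ∀ T, 0 ≤ slack a b D T) :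
    ∃ h : E → Option V, (∀ e v, h e = some v → a e = v ∨ b e = v) ∧
      ∀ v, (Nat.card {e // h e = some v} : ℤ) = D v + 1 := by
  classical
  -- Each vertex `v` offers `D v + 1` slots, to be matched injectively with edges at `v`. Unmatched
  -- edges stay unoriented.
  let ι := Σ v : V, Fin (D v + 1).toNat
  let t : ι → Finset E := fun i => Finset.univ.filter fun e => a e = i.1 ∨ b e = i.1
  have hall : ∀ A : Finset ι, A.card ≤ (A.biUnion t).card := by
    intro A
    set S := A.image Sigma.fst with hS
    have h1 : A ⊆ S.sigma fun _ => Finset.univ := fun i hi => by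
      exact Finset.mem_sigma.2 ⟨Finset.mem_image_of_mem _ hi, Finset.mem_univ _⟩
    have h2 : A.biUnion t = Finset.univ.filter fun e => a e ∈ S ∨ b e ∈ S := by
      ext e
      simp only [Finset.mem_biUnion, t, hS, Finset.mem_filter, Finset.mem_univ, true_and,
        Finset.mem_image]
      constructor
      · rintro ⟨i, hi, h | h⟩
        · exact Or.inl ⟨i, hi, h.symm⟩
        · exact Or.inr ⟨i, hi, h.symm⟩
      · rintro (⟨i, hi, h⟩ | ⟨i, hi, h⟩)
        · exact ⟨i, hi, Or.inl h.symm⟩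
        · exact ⟨i, hi, Or.inr h.symm⟩
    have h3 := Finset.card_le_card h1
    rw [Finset.card_sigma] at h3
    have h4 := hs S
    have h5 : ((∑ v ∈ S, (Finset.univ : Finset (Fin (D v + 1).toNat)).card : ℕ) : ℤ)
        = ∑ v ∈ S, (D v + 1) := by
      push_cast
      exact Finset.sum_congr rfl fun v _ => by simp [hD v]
    have h6 : ((A.biUnion t).card : ℤ) = ∑ e, (if a e ∈ S ∨ b e ∈ S then (1 : ℤ) else 0) := by
      rw [h2]; simp
    simp only [slack] at h4
    omega
  obtain ⟨φ, hφ, hφt⟩ := (Finset.all_card_le_biUnion_card_iff_exists_injective t).1 hall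
  let h : E → Option V := fun e => if he : ∃ i, φ i = e then some he.choose.1 else none
  have hh : ∀ i, h (φ i) = some i.1 := fun i => by
    have he : ∃ j, φ j = φ i := ⟨i, rfl⟩
    simp only [h, dif_pos he, hφ he.choose_spec]
  have hh' : ∀ e v, h e = some v → ∃ k, φ ⟨v, k⟩ = e := fun e v hev => by
    by_cases he : ∃ i, φ i = e
    · obtain ⟨i, rfl⟩ := he
      rw [hh] at hev
      obtain rfl := Option.some_injective _ hev
      exact ⟨i.2, rfl⟩
    · simp [h, he] at hev
  refine ⟨h, fun e v hev => ?_, fun v => ?_⟩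
  · obtain ⟨k, rfl⟩ := hh' e v hev
    simpa [t] using hφt ⟨v, k⟩
  · have : Nat.card (Fin (D v + 1).toNat) = Nat.card {e // h e = some v} := by
      refine Nat.card_congr (Equiv.ofBijective (fun k => ⟨φ ⟨v, k⟩, hh _⟩) ⟨?_, ?_⟩)
      · intro k l hkl
        have := hφ (congrArg Subtype.val hkl)
        exact eq_of_heq (Sigma.mk.inj this).2
      · rintro ⟨e, he⟩
        obtain ⟨k, hk⟩ := hh' e v he
        exact ⟨k, Subtype.ext hk⟩
    rw [← this]
    simp [hD v]

end EdgeLap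

/-! ### Translation to multigraphs and the rank -/

variable {α β : Type*} {G : Graph α β}

theorem exists_ends (G : Graph α β) :
    ∃ a b : E(G) → V(G), ∀ e : E(G), G.IsLink e (a e) (b e) := by
  have h : ∀ e : E(G), ∃ x : V(G) × V(G), G.IsLink e x.1 x.2 := fun e => by
    obtain ⟨x, y, hxy⟩ := G.exists_isLink_of_mem_edgeSet e.2
    exact ⟨⟨⟨x, hxy.left_mem⟩, ⟨y, hxy.right_mem⟩⟩, hxy⟩
  choose x hx using h
  exact ⟨fun e => (x e).1, fun e => (x e).2, hx⟩

theorem inc_iff_of_isLink {e : E(G)} {x y v : V(G)} (h : G.IsLink e x y) :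
    G.Inc e v ↔ x = v ∨ y = v := by
  constructor
  · intro hv
    rcases hv.eq_or_eq_of_isLink h with h | h
    · exact Or.inl (Subtype.ext h.symm)
    · exact Or.inr (Subtype.ext h.symm)
  · rintro (rfl | rfl)
    · exact h.inc_left
    · exact h.inc_right

theorem isLink_iff_of_isLink {e : E(G)} {x y u v : V(G)} (h : G.IsLink e x y) :
    G.IsLink e u v ↔ (x = u ∧ y = v) ∨ (x = v ∧ y = u) := by
  rw [h.isLink_iff]
  simp only [Subtype.ext_iff]

theorem laplacian_mulVec [Fintype V(G)] [Fintype E(G)] [G.Loopless] [DecidableEq V(G)]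
    {a b : E(G) → V(G)} (hab : ∀ e : E(G), G.IsLink e (a e) (b e)) (f : V(G) → ℤ) (v : V(G)) :
    (laplacian G).mulVec f v = edgeLap a b f v := by
  classical
  have hne : ∀ e, a e ≠ b e := fun e h => (hab e).ne (congrArg Subtype.val h)
  have hdeg : (degree G v : ℤ) =
      ∑ e, ((if a e = v then 1 else 0) + (if b e = v then 1 else 0) : ℤ) := by
    rw [degree, Nat.card_eq_fintype_card, Fintype.card_subtype, Finset.card_filter]
    push_cast
    refine Finset.sum_congr rfl fun e _ => ?_
    have := hne e
    rw [inc_iff_of_isLink (hab e)]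
    by_cases h1 : a e = v <;> by_cases h2 : b e = v <;> simp_all
  have hmul : ∀ u, (multiplicity G v u : ℤ) = ∑ e,
      ((if a e = v then if b e = u then 1 else 0 else 0) +
        (if b e = v then if a e = u then 1 else 0 else 0) : ℤ) := fun u => by
    rw [multiplicity, Nat.card_eq_fintype_card, Fintype.card_subtype, Finset.card_filter]
    push_cast
    refine Finset.sum_congr rfl fun e _ => ?_
    have := hne e
    rw [isLink_iff_of_isLink (hab e)]
    by_cases h1 : a e = v <;> by_cases h2 : b e = v <;> by_cases h3 : a e = u <;>
      by_cases h4 : b e = u <;> simp_all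
  have h1 : (laplacian G).mulVec f v
      = degree G v * f v - ∑ u, (multiplicity G v u : ℤ) * f u := by
    simp only [laplacian, Matrix.sub_mulVec, Matrix.mulVec_diagonal, Pi.sub_apply]
    rfl
  have h2 : ∑ u, (multiplicity G v u : ℤ) * f u = ∑ e,
      ((if a e = v then f (b e) else 0) + if b e = v then f (a e) else 0) := by
    simp only [hmul, Finset.sum_mul]
    rw [Finset.sum_comm]
    refine Finset.sum_congr rfl fun e _ => ?_
    by_cases h1 : a e = v <;> by_cases h2 : b e = v <;>
      simp [h1, h2, add_mul, Finset.sum_add_distrib]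
  rw [h1, h2, hdeg, Finset.sum_mul, ← Finset.sum_sub_distrib]
  refine Finset.sum_congr rfl fun e _ => ?_
  have := hne e
  by_cases h1 : a e = v <;> by_cases h2 : b e = v <;> simp_all

theorem linEquiv_iff [Fintype V(G)] [Fintype E(G)] [G.Loopless] [DecidableEq V(G)]
    {a b : E(G) → V(G)} (hab : ∀ e : E(G), G.IsLink e (a e) (b e)) {D D' : Divisor G} :
    LinEquiv D D' ↔ ∃ f, ∀ v, D' v = D v - edgeLap a b f v := by
  refine exists_congr fun f => ?_
  rw [funext_iff]
  refine forall_congr' fun v => ?_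
  rw [laplacian_mulVec hab, Pi.sub_apply]
  constructor <;> intro h <;> linarith

theorem unwinnable_zero_iff [Fintype V(G)] (D : Divisor G) :
    Unwinnable D 0 ↔ ¬ ∃ E' : Divisor G, 0 ≤ E' ∧ LinEquiv D E' := by
  constructor
  · rintro ⟨E, h0, hdeg, h⟩
    have : E = 0 := by
      have h1 := (Finset.sum_eq_zero_iff_of_nonneg fun v _ => h0 v).1
        (show ∑ v, E v = 0 by simpa [Divisor.deg] using hdeg)
      exact funext fun v => h1 v (Finset.mem_univ v)
    rwa [this, sub_zero] at h
  · intro h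
    exact ⟨0, le_rfl, by simp [Divisor.deg], by rwa [sub_zero]⟩

theorem rank_eq_neg_one_iff [Fintype V(G)] [Fintype E(G)] [Nonempty V(G)] (D : Divisor G) :
    rank D = -1 ↔ ¬ ∃ E' : Divisor G, 0 ≤ E' ∧ LinEquiv D E' := by
  rw [← unwinnable_zero_iff]
  have hne : {n : ℕ | Unwinnable D n}.Nonempty := exists_unwinnable D
  have h : rank D = -1 ↔ sInf {n : ℕ | Unwinnable D n} = 0 := by
    unfold rank; omega
  rw [h, Nat.sInf_eq_zero]
  exact or_iff_left hne.ne_empty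

theorem rank_nonneg_iff [Fintype V(G)] [Fintype E(G)] [Nonempty V(G)] (D : Divisor G) :
    0 ≤ rank D ↔ ∃ E' : Divisor G, 0 ≤ E' ∧ LinEquiv D E' := by
  have h1 := rank_eq_neg_one_iff D
  have h2 : -1 ≤ rank D := by unfold rank; omega
  rw [← not_iff_not, ← h1]
  omega

/-! ### Acyclic and sourceless partial orientations -/

namespace PartialOrientation

/-- In an acyclic partial orientation every nonempty set contains a vertex without incoming edges
from that set. -/
theorem Acyclic.exists_source [Finite V(G)] {O : PartialOrientation G} (hO : O.Acyclic)
    {S : Set V(G)} (hS : S.Nonempty) : ∃ v ∈ S, ∀ u ∈ S, ¬ O.Arrow u v := by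
  by_contra! hcon
  have : ∀ v : S, ∃ u : S, O.Arrow u v := fun v => by
    obtain ⟨u, hu, h⟩ := hcon v v.2
    exact ⟨⟨u, hu⟩, h⟩
  choose p hp using this
  obtain ⟨x₀, hx₀⟩ := hS
  obtain ⟨m, n, hmn, heq⟩ :=
    Finite.exists_ne_map_eq_of_infinite fun k : ℕ => p^[k] ⟨x₀, hx₀⟩
  obtain ⟨x, hx⟩ : ∃ x, x ∈ Function.periodicPts p := by
    wlog hlt : m < n generalizing m n
    · exact this n m hmn.symm heq.symm (by omega)
    refine ⟨p^[m] ⟨x₀, hx₀⟩, Function.mk_mem_periodicPts (n := n - m) (by omega) ?_⟩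
    rw [Function.IsPeriodicPt, Function.IsFixedPt, ← Function.iterate_add_apply,
      Nat.sub_add_cancel hlt.le]
    exact heq.symm
  obtain ⟨k, hk⟩ : ∃ k, Function.minimalPeriod p x = k + 1 :=
    ⟨_, (Nat.succ_pred_eq_of_pos (Function.minimalPeriod_pos_of_mem_periodicPts hx)).symm⟩
  -- The map `p` goes from head to tail, so its orbit is traversed backwards; the minimal period
  -- makes the vertices distinct.
  refine hO ⟨k, fun i => p^[k - i] x, fun i j hij => ?_, fun i => ?_⟩
  · have h := (Function.iterate_injOn_Iio_minimalPeriod (f := p) (x := x))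
      (x₁ := k - i) (x₂ := k - j) (by simp [hk]) (by simp [hk])
      (Subtype.ext hij)
    ext
    omega
  · have hstep : p^[k - i] x = p (p^[k - (i + 1 : Fin (k + 1))] x) := by
      rw [← Function.iterate_succ_apply' p]
      rcases eq_or_ne i (Fin.last k) with rfl | hi
      · rw [Fin.last_add_one]
        have := Function.iterate_minimalPeriod (f := p) (x := x)
        rw [hk] at this
        simpa using this.symm
      · have h1 : ((i + 1 : Fin (k + 1)) : ℕ) = i + 1 :=
          Fin.val_add_one_of_lt (Fin.lt_last_iff_ne_last.2 hi)
        have h2 : (i : ℕ) < k := Fin.lt_last_iff_ne_last.2 hi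
        rw [h1]
        congr 1
        omega
    simp only [hstep]
    exact hp _

/-- A partial orientation whose edges go up along a function is acyclic. -/
theorem acyclic_of_lt {O : PartialOrientation G} (ρ : V(G) → ℕ)
    (h : ∀ u v, O.Arrow u v → ρ u < ρ v) : O.Acyclic := by
  rintro ⟨n, c, -, hc⟩
  obtain ⟨i, -, hi⟩ := Finset.exists_max_image Finset.univ (fun i => ρ (c i)) ⟨0, Finset.mem_univ _⟩
  exact absurd (h _ _ (hc i)) (not_lt.2 (hi _ (Finset.mem_univ _)))

theorem indeg_eq_sum [Fintype E(G)] [DecidableEq V(G)] (O : PartialOrientation G) (v : V(G)) :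
    (O.indeg v : ℤ) = ∑ e, if O.head e = some v then (1 : ℤ) else 0 := by
  rw [indeg, Nat.card_eq_fintype_card, Fintype.card_subtype, Finset.card_filter]
  push_cast
  rfl

/-- A divisor below that of an acyclic partial orientation is not equivalent to an effective one. -/
theorem Acyclic.not_effective [Fintype V(G)] [Fintype E(G)] [Nonempty V(G)] [G.Loopless]
    {O : PartialOrientation G} (hO : O.Acyclic) {D : Divisor G} (hD : D ≤ O.divisor)
    {a b : E(G) → V(G)} (hab : ∀ e : E(G), G.IsLink e (a e) (b e)) [DecidableEq V(G)]
    (f : V(G) → ℤ) : ∃ v, D v - edgeLap a b f v < 0 := by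
  obtain ⟨m, hm⟩ := Finite.exists_max f
  obtain ⟨v, hv, hsrc⟩ := hO.exists_source (S := {v | ∀ u, f u ≤ f v}) ⟨m, hm⟩
  refine ⟨v, ?_⟩
  have h1 : (O.indeg v : ℤ) ≤ edgeLap a b f v := by
    rw [indeg_eq_sum]
    refine Finset.sum_le_sum fun e _ => ?_
    have hne : a e ≠ b e := fun h => (hab e).ne (congrArg Subtype.val h)
    have hlt : ∀ u, O.Arrow u v → f u + 1 ≤ f v := fun u hu => by
      by_contra hcon
      exact hsrc u (fun w => by have := hv w; omega) hu
    by_cases ha : a e = v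
    · have hb : b e ≠ v := fun h => hne (ha.trans h.symm)
      have h2 := hv (b e)
      simp only [ha, hb, if_true, if_false]
      split_ifs with h
      · have := hlt (b e) ⟨e, h, by rw [← ha]; exact (hab e).symm⟩
        linarith
      · linarith
    · by_cases hb : b e = v
      · have h2 := hv (a e)
        simp only [ha, hb, if_true, if_false]
        split_ifs with h
        · have := hlt (a e) ⟨e, h, by rw [← hb]; exact hab e⟩
          linarith
        · linarith
      · have : O.head e ≠ some v := fun h => by
          rcases (inc_iff_of_isLink (hab e)).1 (O.inc_head e v h) with h | h
          · exact ha h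
          · exact hb h
        simp [ha, hb, this]
  have h2 : D v ≤ (O.indeg v : ℤ) - 1 := hD v
  linarith

theorem Sourceless.divisor_nonneg [Finite E(G)] {O : PartialOrientation G} (hO : O.Sourceless) :
    0 ≤ O.divisor := fun v => by
  have h := hO v
  simp only [IsSource, not_forall, not_not] at h
  obtain ⟨e, he⟩ := h
  have : Nonempty {e : E(G) // O.head e = some v} := ⟨⟨e, he⟩⟩
  have h1 : 0 < O.indeg v := Nat.card_pos
  simp only [divisor, Pi.zero_apply]
  omega

end PartialOrientation

/-! ### The two existence statements and the theorem -/

theorem exists_acyclic_of_not_effective [Fintype V(G)] [Fintype E(G)] [G.Loopless]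
    (hG : G.toSimpleGraph.Connected) (D : Divisor G)
    (hD : ¬ ∃ E' : Divisor G, 0 ≤ E' ∧ LinEquiv D E') :
    ∃ D' : Divisor G, LinEquiv D D' ∧ ∃ O : PartialOrientation G, O.Acyclic ∧ D' ≤ O.divisor := by
  classical
  obtain ⟨a, b, hab⟩ := exists_ends G
  obtain ⟨q⟩ := hG.nonempty
  obtain ⟨w, hwq, hw, hw'⟩ := exists_potential a b q (fun v => G.toSimpleGraph.dist v q)
    (by simp) fun v hv => by
      obtain ⟨p, hp⟩ := hG.exists_walk_length_eq_dist v q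
      cases p with
      | nil => exact absurd rfl hv
      | @cons _ u _ h p =>
        have hlt : G.toSimpleGraph.dist u q < G.toSimpleGraph.dist v q := by
          have := SimpleGraph.dist_le p
          rw [← hp, SimpleGraph.Walk.length_cons]
          omega
        obtain ⟨e, he⟩ := (Graph.toSimpleGraph_adj_iff v u).1 h
        refine ⟨⟨e, he.edge_mem⟩, ?_⟩
        rcases (isLink_iff_of_isLink (hab ⟨e, he.edge_mem⟩)).1 he with ⟨h1, h2⟩ | ⟨h1, h2⟩
        · exact Or.inl ⟨h1, by rwa [h2]⟩
        · exact Or.inr ⟨h2, by rwa [h1]⟩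
  obtain ⟨f, hf, hred⟩ := exists_reduced a b q w hwq hw hw' D
  set D' : Divisor G := fun v => D v - edgeLap a b f v with hD'
  have hequiv : LinEquiv D D' := (linEquiv_iff hab).2 ⟨f, fun _ => rfl⟩
  have hq : D' q < 0 := by
    by_contra! hq
    refine hD ⟨D', fun v => ?_, hequiv⟩
    by_cases hv : v = q
    · exact hv ▸ hq
    · exact hf v hv
  have hburn : ∀ S : Finset V(G), S.Nonempty → ∃ v ∈ S, D' v + 1 ≤ edgeLap a b (indicator S) v := by
    intro S hS
    by_cases hqS : q ∈ S
    -- Sets containing `q` burn at `q`, which is in debt, so the fire reaches every vertex.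
    · refine ⟨q, hqS, le_trans (show D' q + 1 ≤ 0 by omega) (Finset.sum_nonneg fun e _ => ?_)⟩
      simp only [indicator]
      by_cases h1 : a e = q <;> by_cases h2 : b e = q <;> by_cases h3 : a e ∈ S <;>
        by_cases h4 : b e ∈ S <;> simp_all
    · exact hred S hS hqS
  obtain ⟨ρ, hρ, hlt⟩ := exists_burning_order a b D' hburn Finset.univ
  have hne : ∀ e, a e ≠ b e := fun e h => (hab e).ne (congrArg Subtype.val h)
  refine ⟨D', hequiv, ⟨fun e => some (if ρ (b e) < ρ (a e) then a e else b e), fun e v h => ?_⟩,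
    PartialOrientation.acyclic_of_lt ρ ?_, fun v => ?_⟩
  · rw [inc_iff_of_isLink (hab e)]
    split_ifs at h
    · exact Or.inl (Option.some_injective _ h)
    · exact Or.inr (Option.some_injective _ h)
  · rintro u v ⟨e, he, hl⟩
    have hρe : ρ (a e) ≠ ρ (b e) := fun h => hne e (hρ (by simp) (by simp) h)
    have he' := Option.some_injective _ he
    rcases (isLink_iff_of_isLink (hab e)).1 hl with ⟨rfl, rfl⟩ | ⟨rfl, rfl⟩
    · split_ifs at he' with h
      · exact absurd he' (hne e)
      · omega
    · split_ifs at he' with h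
      · exact h
      · exact absurd he'.symm (hne e)
  · have h1 := hlt v (Finset.mem_univ v)
    have h2 : ∀ O : PartialOrientation G,
        (∀ e, O.head e = some (if ρ (b e) < ρ (a e) then a e else b e)) →
        D' v ≤ O.divisor v := fun O hO => by
      refine Int.le_sub_one_of_lt (h1.trans_le ?_)
      rw [O.indeg_eq_sum]
      refine Finset.sum_le_sum fun e _ => ?_
      simp only [hO, Finset.mem_univ, not_true, false_or, Option.some_inj]
      by_cases h5 : ρ (b e) < ρ (a e)
      · rw [if_pos h5, if_neg (c := b e = v ∧ _) fun h => by have := h.1 ▸ h.2; omega, add_zero]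
        split_ifs with h3 h4 <;> first | exact absurd h3.1 h4 | norm_num
      · rw [if_neg h5, if_neg (c := a e = v ∧ _) fun h => h5 (by rw [h.1]; exact h.2), zero_add]
        split_ifs with h3 h4 <;> first | exact absurd h3.1 h4 | norm_num
    exact h2 _ fun _ => rfl

theorem exists_sourceless_of_effective [Fintype V(G)] [Fintype E(G)] [G.Loopless]
    (hG : G.toSimpleGraph.Connected) (D : Divisor G) (hD : D.deg ≤ genus G - 1) {E' : Divisor G}
    (hE' : 0 ≤ E') (hDE : LinEquiv D E') :
    ∃ O : PartialOrientation G, O.Sourceless ∧ LinEquiv D O.divisor := by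
  classical
  obtain ⟨a, b, hab⟩ := exists_ends G
  have hne : ∀ e, a e ≠ b e := fun e h => (hab e).ne (congrArg Subtype.val h)
  have hconn : ∀ S : Finset V(G), S.Nonempty → S ≠ Finset.univ →
      ∃ e, ¬ (a e ∈ S ↔ b e ∈ S) := by
    rintro S ⟨x, hx⟩ hS
    obtain ⟨y, hy⟩ : ∃ y, y ∉ S := by
      by_contra! h
      exact hS (Finset.eq_univ_iff_forall.2 h)
    obtain ⟨p⟩ := hG.preconnected x y
    obtain ⟨d, -, hd1, hd2⟩ := p.exists_boundary_dart (S : Set V(G)) hx hy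
    obtain ⟨e, he⟩ := (Graph.toSimpleGraph_adj_iff _ _).1 d.adj
    refine ⟨⟨e, he.edge_mem⟩, ?_⟩
    simp only [Finset.mem_coe] at hd1 hd2
    rcases (isLink_iff_of_isLink (hab ⟨e, he.edge_mem⟩)).1 he with ⟨h1, h2⟩ | ⟨h1, h2⟩
    · rw [h1, h2]; tauto
    · rw [h1, h2]; tauto
  have huniv : 0 ≤ slack a b E' Finset.univ := by
    have h1 := hDE.deg_eq
    simp only [slack, Finset.mem_univ, or_self, if_true, Finset.sum_add_distrib,
      Finset.sum_const, Finset.card_univ, nsmul_eq_mul, mul_one]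
    simp only [genus, Divisor.deg] at hD h1
    linarith
  have hbd : ∀ T, -((∑ S : Finset V(G), (slack a b E' S).natAbs : ℕ) : ℤ) ≤ slack a b E' T :=
    fun T => by
      have := Finset.single_le_sum (f := fun S : Finset V(G) => (slack a b E' S).natAbs)
        (fun _ _ => Nat.zero_le _) (Finset.mem_univ T)
      omega
  obtain ⟨f, hf, hs⟩ := exists_slack_nonneg a b hne hconn _ E' hE' huniv hbd
  obtain ⟨h, hh, hcard⟩ := exists_heads a b _ (fun v => (hf v).trans (by linarith)) hs
  obtain ⟨g, hg⟩ := (linEquiv_iff hab).1 hDE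
  refine ⟨⟨h, fun e v hev => (inc_iff_of_isLink (hab e)).2 (hh e v hev)⟩, fun v hv => ?_,
    (linEquiv_iff hab).2 ⟨g + f, fun v => ?_⟩⟩
  · have h1 := hcard v
    have : IsEmpty {e // h e = some v} := ⟨fun e => hv e.1 e.2⟩
    rw [Nat.card_of_isEmpty] at h1
    have := hf v
    simp only [Nat.cast_zero] at h1
    omega
  · have h1 := hcard v
    have h2 := hg v
    rw [edgeLap_add]
    simp only [PartialOrientation.divisor, PartialOrientation.indeg]
    linarith

end ChipFiring

theorem theorem4 {α β : Type*} (G : Graph α β) [Fintype V(G)] [Fintype E(G)] [G.Loopless]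
    (hG : G.toSimpleGraph.Connected) (D : ChipFiring.Divisor G)
    (hD : D.deg ≤ ChipFiring.genus G - 1) :
    (ChipFiring.rank D = -1 ↔
      ∃ D' : ChipFiring.Divisor G, ChipFiring.LinEquiv D D' ∧
        ∃ O : ChipFiring.PartialOrientation G, O.Acyclic ∧ D' ≤ O.divisor) ∧
    (0 ≤ ChipFiring.rank D ↔
      ∃ O : ChipFiring.PartialOrientation G, O.Sourceless ∧
        ChipFiring.LinEquiv D O.divisor) := by
  classical
  have := hG.nonempty
  rw [ChipFiring.rank_eq_neg_one_iff, ChipFiring.rank_nonneg_iff]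
  refine ⟨⟨ChipFiring.exists_acyclic_of_not_effective hG D, ?_⟩, ?_, ?_⟩
  · rintro ⟨D', hDD', O, hO, hle⟩ ⟨E', hE', hDE⟩
    obtain ⟨a, b, hab⟩ := ChipFiring.exists_ends G
    obtain ⟨f, hf⟩ := (ChipFiring.linEquiv_iff hab).1 hDD'
    obtain ⟨g, hg⟩ := (ChipFiring.linEquiv_iff hab).1 hDE
    -- `g - f` leads from `D'` through `D` to `E'`.
    obtain ⟨v, hv⟩ := hO.not_effective hle hab (g + (-1 : ℤ) • f)
    have h1 : 0 ≤ E' v := hE' v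
    rw [ChipFiring.edgeLap_add, ChipFiring.edgeLap_smul] at hv
    linarith [hf v, hg v]
  · rintro ⟨E', hE', hDE⟩
    exact ChipFiring.exists_sourceless_of_effective hG D hD hE' hDE
  · rintro ⟨O, hO, hDO⟩
    exact ⟨O.divisor, hO.divisor_nonneg, hDO⟩
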